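/- Let $G$ be a group, $I$ a set, and let $G[X_i, i\in I] = G * F(X_i, i\in I)$ be the free product of $G$ with the free group on $(X_i)_{i\in I}$; identify $G$ with its canonical image in it. For $x\in G[X_i, i\in I]$ let $G(x)$ be the subgroup generated by the elements $gxg^{-1}$, $g\in G$. Call $x$ a $T_1$-divisor of zero if $x\neq 1$ and there is $y\in G[X_i, i\in I]$, $y\neq 1$, with $[G(x),G(y)]=\{1\}$, where $[L,L']$ denotes the subgroup generated by the elements $\ell\ell'\ell^{-1}\ell'^{-1}$, $\ell\in L$, $\ell'\in L'$. 1. If $G$ is neither trivial nor isomorphic to $\mathbb{Z}/2$, then every $T_1$-divisor of zero of $G[X_i, i\in I]$ lies in $G$. 2. If $G$ is trivial, then every $x\neq 1$ in $G[X_i, i\in I]$ is a $T_1$-divisor of zero, and $X_i\notin G$ for every $i\in I$. 3. If $G\cong\mathbb{Z}/2$ and $g$ is the element of $G$ distinct from $1$, then for every $i\in I$ the element $gX_igX_i^{-1}$ is a $T_1$-divisor of zero which does not lie in $G$. -/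

import Mathlib

universe u v w

/-- The group `G[X_i, i ∈ I]`: the free product of `G` and the free group on `(X_i)_{i ∈ I}`. -/
abbrev PolyGroup (G : Type u) [Group G] (I : Type v) : Type (max u v) :=
  Monoid.Coprod G (FreeGroup I)

namespace PolyGroup

/-- The canonical (injective) morphism `G → G[X_i, i ∈ I]`. Its range is the copy of `G` inside
`G[X_i, i ∈ I]`. -/
def const (G : Type u) [Group G] (I : Type v) : G →* PolyGroup G I :=
  Monoid.Coprod.inl

/-- The indeterminate `X_i` of `G[X_i, i ∈ I]`. -/
def X (G : Type u) [Group G] {I : Type v} (i : I) : PolyGroup G I :=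
  Monoid.Coprod.inr (FreeGroup.of i)

end PolyGroup

/-- For a `G`-group `f : G →* H` and `x : H`, the subgroup `G(x)` of `H` generated by
the elements `f(g) x f(g)⁻¹`, `g ∈ G`. -/
def conjSubgroup {G : Type u} {H : Type w} [Group G] [Group H] (f : G →* H) (x : H) :
    Subgroup H :=
  Subgroup.closure (Set.range fun g : G => f g * x * (f g)⁻¹)

/-- `x` is a `T₁`-divisor of zero of the `G`-group `f : G →* H`: `x ≠ 1` and there is `y ≠ 1`
with `[G(x), G(y)] = 1`. -/
def IsT1DivisorOfZero {G : Type u} {H : Type w} [Group G] [Group H] (f : G →* H) (x : H) :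
    Prop :=
  x ≠ 1 ∧ ∃ y : H, y ≠ 1 ∧ ⁅conjSubgroup f x, conjSubgroup f y⁆ = ⊥

namespace Monoid.CoprodI

variable {ι : Type*} {M : ι → Type*} [∀ i, Group (M i)]

namespace NeWord

/-! Normal forms in a free product: equal reduced words begin in the same factor. If `x` lies
outside the factor `o`, a conjugate of it is `w * c`, with `w` reduced, starting and ending outside
`o`, and `c` in `o`; the same holds for `y` unless it lies in `o`. Conjugating one of them by a
suitable `g` in `o` makes the two products reduced with first letters in different factors, so they
cannot commute. Such a `g` exists once the factor has more than two elements
(`exists_ne_one_and_ne_of_forall_exists`). For order two, `g` inverts `g X g X⁻¹`, whose conjugates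
by constants thus commute. -/

theorem fst_eq_of_prod_eq {i j k l : ι} {w : NeWord M i j} {v : NeWord M k l}
    (h : w.prod = v.prod) : i = k := by
  classical
  have hw : w.toWord = v.toWord := Word.equiv.symm.injective h
  have hl : w.toList.head? = v.toList.head? := congrArg (fun u : Word M => u.toList.head?) hw
  rw [toList_head?, toList_head?] at hl
  exact congrArg Sigma.fst (Option.some.inj hl)

theorem exists_prod_eq_prod_mul_of {i j o : ι} (w : NeWord M i j) (hj : j ≠ o) (c : M o) :
    ∃ (k : ι) (w' : NeWord M i k), w'.prod = w.prod * of c := by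
  by_cases hc : c = 1
  · exact ⟨j, w, by simp [hc]⟩
  · exact ⟨o, w.append hj (singleton c hc), by simp⟩

theorem fst_eq_of_prod_mul_of_eq {i j k l o : ι} {w : NeWord M i j} {v : NeWord M k l}
    (hj : j ≠ o) (hl : l ≠ o) {c d : M o} (h : w.prod * of c = v.prod * of d) : i = k := by
  obtain ⟨_, w', hw⟩ := w.exists_prod_eq_prod_mul_of hj c
  obtain ⟨_, v', hv⟩ := v.exists_prod_eq_prod_mul_of hl d
  exact fst_eq_of_prod_eq (hw.trans (h.trans hv.symm))

/-- Splitting off the initial letter of a reduced word, if it lies in the factor `o`. -/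
theorem exists_prod_eq_of_mul_prod {i j : ι} (o : ι) (w : NeWord M i j) :
    (j = o ∧ ∃ a : M o, w.prod = of a) ∨
      ∃ (a : M o) (k : ι) (w' : NeWord M k j), k ≠ o ∧ w.prod = of a * w'.prod := by
  induction w with
  | @singleton i x hx =>
    by_cases hi : i = o
    · subst hi
      exact Or.inl ⟨rfl, x, by simp⟩
    · exact Or.inr ⟨1, i, singleton x hx, hi, by simp⟩
  | @append i j k l w₁ hne w₂ ih₁ _ =>
    right
    obtain ⟨rfl, a, ha⟩ | ⟨a, m, w', hm, hw⟩ := ih₁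
    · exact ⟨a, k, w₂, hne.symm, by simp [ha]⟩
    · exact ⟨a, m, w'.append hne w₂, hm, by simp [hw, mul_assoc]⟩

theorem exists_prod_eq_prod_mul_of_of_ne {i j o : ι} (w : NeWord M i j) (hi : i ≠ o) :
    ∃ (k l : ι) (w' : NeWord M k l) (b : M o), k ≠ o ∧ l ≠ o ∧ w.prod = w'.prod * of b := by
  obtain ⟨h, _⟩ | ⟨a, k, w', hk, hw⟩ := exists_prod_eq_of_mul_prod o w.inv
  · exact absurd h hi
  · refine ⟨i, k, w'.inv, a⁻¹, hi, hk, ?_⟩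
    rw [inv_prod] at hw
    rw [inv_prod, ← inv_inv w.prod, hw, mul_inv_rev, map_inv]

end NeWord

theorem mem_range_of_or_exists_neWord (o : ι) (x : CoprodI M) :
    x ∈ (of : M o →* CoprodI M).range ∨
      ∃ (a b : M o) (i j : ι) (w : NeWord M i j), i ≠ o ∧ j ≠ o ∧ x = of a * w.prod * of b := by
  classical
  by_cases hx : x = 1
  · exact Or.inl (hx ▸ one_mem _)
  have hw : Word.equiv x ≠ Word.empty := fun h => hx <| by
    rw [← Word.equiv.symm_apply_apply x, h]
    exact Word.prod_empty
  obtain ⟨i, j, w, hw⟩ := NeWord.of_word _ hw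
  have hxw : x = w.prod := by
    rw [← Word.equiv.symm_apply_apply x, ← hw]
    rfl
  obtain ⟨_, a, ha⟩ | ⟨a, k, w', hk, hw'⟩ := w.exists_prod_eq_of_mul_prod o
  · exact Or.inl ⟨a, (hxw.trans ha).symm⟩
  · obtain ⟨p, q, u, b, hp, hq, hu⟩ := w'.exists_prod_eq_prod_mul_of_of_ne hk
    exact Or.inr ⟨a, b, p, q, u, hp, hq, by rw [hxw, hw', hu, mul_assoc]⟩

/-- Up to conjugation by the factor `o`, an element outside that factor is a reduced word which
neither starts nor ends in the factor, times an element of the factor. -/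
theorem exists_conj_eq_prod_mul_of {o : ι} {x : CoprodI M}
    (hx : x ∉ (of : M o →* CoprodI M).range) :
    ∃ (a c : M o) (i j : ι) (w : NeWord M i j),
      i ≠ o ∧ j ≠ o ∧ of a * x * (of a)⁻¹ = w.prod * of c := by
  obtain h | ⟨a, b, i, j, w, hi, hj, rfl⟩ := mem_range_of_or_exists_neWord o x
  · exact absurd h hx
  · exact ⟨a⁻¹, b * a, i, j, w, hi, hj, by simp [mul_assoc]⟩

theorem not_commute_of_prod_mul_of {o i j : ι} {w : NeWord M i j} (hi : i ≠ o) (hj : j ≠ o)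
    (c : M o) {y : M o} (hy : y ≠ 1) : ¬ Commute (w.prod * of c) (of y) := by
  intro h
  have key : ((NeWord.singleton y hy).append hi.symm w).prod * of c = w.prod * of (c * y) := by
    simpa [mul_assoc] using h.eq.symm
  exact hi (NeWord.fst_eq_of_prod_mul_of_eq hj hj key).symm

/-- The three exclusions on `g` prevent cancellation in both products; one then starts in `o`, the
other with the first letter of `v`. -/
theorem not_commute_conj_of_prod_mul_of {o i j k l : ι} {w : NeWord M i j} {v : NeWord M k l}
    (hi : i ≠ o) (hj : j ≠ o) (hk : k ≠ o) (hl : l ≠ o) {c d g : M o} (hg : g ≠ 1) (hgc : g ≠ c)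
    (hgd : g ≠ d⁻¹) : ¬ Commute (of g * (w.prod * of c) * (of g)⁻¹) (v.prod * of d) := by
  intro h
  have hcg : c * g⁻¹ ≠ 1 := fun e => hgc (mul_inv_eq_one.mp e).symm
  have hdg : d * g ≠ 1 := fun e => hgd (eq_inv_of_mul_eq_one_right e)
  have key : ((((NeWord.singleton g hg).append hi.symm w).append hj
        (NeWord.singleton _ hcg)).append hk.symm v).prod * of d =
      ((v.append hl (NeWord.singleton _ hdg)).append hi.symm w).prod * of (c * g⁻¹) := by
    simpa [mul_assoc] using h.eq
  exact hk (NeWord.fst_eq_of_prod_mul_of_eq hl hj key).symm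

end Monoid.CoprodI

/-- In a group of order three, `1`, `c`, `d⁻¹` may exhaust the group; allowing `c⁻¹` in place of `c`
rescues this case. Failure would make `c` an involution and the only element besides `1` and `d⁻¹`.
-/
theorem exists_ne_one_and_ne_of_forall_exists {G : Type*} [Group G]
    (hG : ∀ a : G, ∃ g, g ≠ 1 ∧ g ≠ a) (c d : G) :
    ∃ g : G, g ≠ 1 ∧ g ≠ d⁻¹ ∧ (g ≠ c ∨ g ≠ c⁻¹) := by
  by_contra! H
  obtain ⟨g, hg, hgd⟩ := hG d⁻¹
  obtain ⟨rfl, hgg⟩ := H g hg hgd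
  by_cases hd : d = 1
  · obtain ⟨k, hk, hkg⟩ := hG g
    exact hkg (H k hk (by simpa [hd] using hk)).1
  by_cases hdd : d = d⁻¹
  · have hne : g * d ≠ 1 := fun e => hgd (eq_inv_of_mul_eq_one_left e)
    have hne' : g * d ≠ d⁻¹ := fun e => hg (mul_eq_right.mp (e.trans hdd.symm))
    exact hd (mul_eq_left.mp (H _ hne hne').1)
  · obtain rfl := (H d hd hdd).1
    exact hgd hgg

namespace Monoid.CoprodI

variable {ι : Type*} {M : ι → Type*} [∀ i, Group (M i)]

theorem mem_range_of_commute_conj {o : ι} (ho : ∀ a : M o, ∃ g, g ≠ 1 ∧ g ≠ a)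
    {x y : CoprodI M} (hy : y ≠ 1)
    (h : ∀ a b : M o, Commute (of a * x * (of a)⁻¹) (of b * y * (of b)⁻¹)) :
    x ∈ (of : M o →* CoprodI M).range := by
  by_contra hx
  obtain ⟨a, c, i, j, w, hi, hj, hw⟩ := exists_conj_eq_prod_mul_of hx
  by_cases hyo : y ∈ (of : M o →* CoprodI M).range
  · obtain ⟨y, rfl⟩ := hyo
    have := h a 1
    rw [hw, map_one, one_mul, inv_one, mul_one] at this
    exact not_commute_of_prod_mul_of hi hj c (fun e => hy (by rw [e, map_one])) this
  obtain ⟨b, d, k, l, v, hk, hl, hv⟩ := exists_conj_eq_prod_mul_of hyo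
  have hwv : ∀ g : M o, Commute (of g * (w.prod * of c) * (of g)⁻¹) (v.prod * of d) := by
    intro g
    have := h (g * a) b
    rw [hv] at this
    simpa [← hw, mul_assoc] using this
  obtain ⟨g, hg, hgd, hgc | hgc⟩ := exists_ne_one_and_ne_of_forall_exists ho c d
  · exact not_commute_conj_of_prod_mul_of hi hj hk hl hg hgc hgd (hwv g)
  -- Replace `x` by its inverse: the conjugate of `(w * c)⁻¹` by `c` is `w⁻¹ * c⁻¹`, so `c⁻¹` plays
  -- the role of `c`.
  · refine not_commute_conj_of_prod_mul_of (w := w.inv) (v := v) hj hi hk hl hg hgc hgd ?_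
    have := (hwv (g * c)).inv_left
    simpa [mul_assoc] using this

end Monoid.CoprodI

namespace PolyGroup

variable (G : Type u) [Group G] (I : Type v)

/-- The two factors of `PolyGroup G I`, as a family of groups in a common universe. -/
def Factor : Bool → Type (max u v)
  | true => ULift.{v} G
  | false => ULift.{u} (FreeGroup I)

instance : ∀ b, Group (Factor G I b)
  | true => inferInstanceAs (Group (ULift.{v} G))
  | false => inferInstanceAs (Group (ULift.{u} (FreeGroup I)))

/-- The inclusion of `G` in the free product of the family `Factor G I`. -/
def ofConst : G →* Monoid.CoprodI (Factor G I) :=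
  (Monoid.CoprodI.of (M := Factor G I) (i := true)).comp
    (MulEquiv.ulift.symm : G ≃* ULift.{v} G).toMonoidHom

/-- The inclusion of the free group in the free product of the family `Factor G I`. -/
def ofFree : FreeGroup I →* Monoid.CoprodI (Factor G I) :=
  (Monoid.CoprodI.of (M := Factor G I) (i := false)).comp
    (MulEquiv.ulift.symm : FreeGroup I ≃* ULift.{u} (FreeGroup I)).toMonoidHom

/-- The inclusions of the two factors in `PolyGroup G I`. -/
def factorHom : ∀ b, Factor G I b →* PolyGroup G I
  | true => (Monoid.Coprod.inl : G →* PolyGroup G I).comp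
      (MulEquiv.ulift : ULift.{v} G ≃* G).toMonoidHom
  | false => (Monoid.Coprod.inr : FreeGroup I →* PolyGroup G I).comp
      (MulEquiv.ulift : ULift.{u} (FreeGroup I) ≃* FreeGroup I).toMonoidHom

/-- The comparison morphism from the binary free product to the indexed free product. -/
def toCoprodI : PolyGroup G I →* Monoid.CoprodI (Factor G I) :=
  Monoid.Coprod.lift (ofConst G I) (ofFree G I)

theorem lift_factorHom_toCoprodI (x : PolyGroup G I) :
    Monoid.CoprodI.lift (factorHom G I) (toCoprodI G I x) = x := by
  suffices h : (Monoid.CoprodI.lift (factorHom G I)).comp (toCoprodI G I) = MonoidHom.id _ from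
    DFunLike.congr_fun h x
  apply Monoid.Coprod.hom_ext
  · ext g
    exact Monoid.CoprodI.lift_of (M := Factor G I) (factorHom G I) (i := true) (ULift.up g)
  · apply MonoidHom.ext
    intro f
    exact Monoid.CoprodI.lift_of (M := Factor G I) (factorHom G I) (i := false) (ULift.up f)

variable {G I}

theorem toCoprodI_injective : Function.Injective (toCoprodI G I) :=
  Function.LeftInverse.injective (lift_factorHom_toCoprodI G I)

theorem toCoprodI_const (g : G) :
    toCoprodI G I (const G I g) =
      Monoid.CoprodI.of (M := Factor G I) (i := true) (ULift.up g) :=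
  Monoid.Coprod.lift_apply_inl _ _ g

theorem mem_range_const_of_commute_conj (hG : ∀ a : G, ∃ g, g ≠ 1 ∧ g ≠ a)
    {x y : PolyGroup G I} (hy : y ≠ 1)
    (h : ∀ a b : G, Commute (const G I a * x * (const G I a)⁻¹)
      (const G I b * y * (const G I b)⁻¹)) : x ∈ (const G I).range := by
  have ho : ∀ a : Factor G I true, ∃ g, g ≠ 1 ∧ g ≠ a := by
    rintro ⟨a⟩
    obtain ⟨g, hg, hga⟩ := hG a
    exact ⟨ULift.up g, fun e => hg (congrArg ULift.down e), fun e => hga (congrArg ULift.down e)⟩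
  have hx : toCoprodI G I x ∈
      (Monoid.CoprodI.of (M := Factor G I) (i := true)).range := by
    refine Monoid.CoprodI.mem_range_of_commute_conj (y := toCoprodI G I y) ho
      (fun e => hy (toCoprodI_injective (e.trans (map_one _).symm))) ?_
    rintro ⟨a⟩ ⟨b⟩
    have := (h a b).map (toCoprodI G I)
    simpa only [map_mul, map_inv, toCoprodI_const] using this
  obtain ⟨⟨g⟩, hg⟩ := hx
  exact ⟨g, toCoprodI_injective ((toCoprodI_const g).trans hg)⟩

theorem X_ne_one (i : I) : X G i ≠ 1 := by
  intro h
  have := congrArg (Monoid.Coprod.snd : PolyGroup G I →* FreeGroup I) h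
  rw [X, Monoid.Coprod.snd_apply_inr, map_one] at this
  exact FreeGroup.of_ne_one i this

/-- A nontrivial constant does not commute with an indeterminate: let `G` act on `Option G`, and
let the indeterminate act as the transposition of `none` and `1`. -/
theorem X_mul_const_ne {g : G} (hg : g ≠ 1) (i : I) :
    X G i * const G I g ≠ const G I g * X G i := by
  classical
  intro h
  let φ : PolyGroup G I →* Equiv.Perm (Option G) :=
    Monoid.Coprod.lift (MulAction.toPermHom G (Option G))
      (FreeGroup.lift fun _ => Equiv.swap none (some 1))
  have hX : φ (X G i) = Equiv.swap none (some 1) := by simp [φ, X]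
  have hc : φ (const G I g) = MulAction.toPermHom G (Option G) g := by simp [φ, const]
  have := congrArg (fun p => φ p none) h
  -- `G` fixes `none`, so the two sides send `none` to `some 1` and `some g`.
  simp [hX, hc] at this
  exact hg this.symm

end PolyGroup

theorem conjSubgroup_commutator_eq_bot_iff {G : Type u} {H : Type w} [Group G] [Group H]
    (f : G →* H) (x y : H) : ⁅conjSubgroup f x, conjSubgroup f y⁆ = ⊥ ↔
      ∀ a b : G, Commute (f a * x * (f a)⁻¹) (f b * y * (f b)⁻¹) := by
  rw [Subgroup.commutator_eq_bot_iff_le_centralizer, conjSubgroup, conjSubgroup,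
    Subgroup.centralizer_closure, Subgroup.closure_le]
  constructor
  · intro h a b
    exact (Subgroup.mem_centralizer_iff.mp (h ⟨a, rfl⟩) _ ⟨b, rfl⟩).symm
  · rintro h _ ⟨a, rfl⟩
    refine Subgroup.mem_centralizer_iff.mpr ?_
    rintro _ ⟨b, rfl⟩
    exact (h a b).symm

theorem exists_ne_one_and_ne_of_not_mulEquiv_zmod_two {G : Type*} [Group G] [Nontrivial G]
    (h : IsEmpty (G ≃* Multiplicative (ZMod 2))) (a : G) : ∃ g, g ≠ 1 ∧ g ≠ a := by
  by_contra! H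
  obtain ⟨b, hb⟩ := exists_ne (1 : G)
  have hcard : Nat.card G = 2 :=
    Nat.card_eq_two_iff.mpr ⟨1, a, fun e => hb ((H b hb).trans e.symm),
      Set.eq_univ_of_forall fun g => (em (g = 1)).imp id (H g)⟩
  have : Fact (Nat.Prime 2) := ⟨Nat.prime_two⟩
  exact h.false (mulEquivOfPrimeCardEq (p := 2) hcard (by simp))

theorem eq_one_or_eq_of_mulEquiv_zmod_two {G : Type*} [Group G]
    (e : G ≃* Multiplicative (ZMod 2)) {g : G} (hg : g ≠ 1) (a : G) : a = 1 ∨ a = g := by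
  have key : ∀ s t : Multiplicative (ZMod 2), s ≠ 1 → t = 1 ∨ t = s := by decide
  have := key (e g) (e a) (by simpa using hg)
  simpa using this

theorem theorem2p1 {G : Type u} [Group G] {I : Type v} :
    (Nontrivial G → IsEmpty (G ≃* Multiplicative (ZMod 2)) →
      ∀ x : PolyGroup G I, IsT1DivisorOfZero (PolyGroup.const G I) x →
        x ∈ (PolyGroup.const G I).range) ∧
    (Subsingleton G →
      (∀ x : PolyGroup G I, x ≠ 1 → IsT1DivisorOfZero (PolyGroup.const G I) x) ∧
      ∀ i : I, PolyGroup.X G i ∉ (PolyGroup.const G I).range) ∧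
    (Nonempty (G ≃* Multiplicative (ZMod 2)) →
      ∀ g : G, g ≠ 1 → ∀ i : I,
        IsT1DivisorOfZero (PolyGroup.const G I)
          (PolyGroup.const G I g * PolyGroup.X G i * PolyGroup.const G I g *
            (PolyGroup.X G i)⁻¹) ∧
        PolyGroup.const G I g * PolyGroup.X G i * PolyGroup.const G I g *
            (PolyGroup.X G i)⁻¹ ∉ (PolyGroup.const G I).range) := by
  refine ⟨fun _ hG x ⟨_, y, hy, hxy⟩ => ?_, fun _ => ⟨fun x hx => ⟨hx, x, hx, ?_⟩, ?_⟩,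
    fun ⟨e⟩ g hg i => ?_⟩
  · exact PolyGroup.mem_range_const_of_commute_conj
      (exists_ne_one_and_ne_of_not_mulEquiv_zmod_two hG) hy
      ((conjSubgroup_commutator_eq_bot_iff _ _ _).mp hxy)
  · refine (conjSubgroup_commutator_eq_bot_iff _ _ _).mpr fun a b => ?_
    rw [Subsingleton.elim a b]
  · rintro i ⟨a, ha⟩
    rw [Subsingleton.elim a 1, map_one] at ha
    exact PolyGroup.X_ne_one i ha.symm
  · have htwo := eq_one_or_eq_of_mulEquiv_zmod_two e hg
    have hgg : g * g = 1 := (htwo (g * g)).resolve_right fun h => hg (mul_eq_left.mp h)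
    set c := PolyGroup.const G I g with hc
    set t := PolyGroup.X G i with ht
    have hcc : c * c = 1 := by rw [hc, ← map_mul, hgg, map_one]
    have hcinv : c⁻¹ = c := inv_eq_of_mul_eq_one_left hcc
    have hne : c * t * c * t⁻¹ ≠ 1 := fun h => PolyGroup.X_mul_const_ne hg i <| by
      rw [mul_inv_eq_one, mul_assoc, ← eq_inv_mul_iff_mul_eq, hcinv] at h
      exact h
    have hconj : c * (c * t * c * t⁻¹) * c⁻¹ = (c * t * c * t⁻¹)⁻¹ := by
      simp only [mul_inv_rev, inv_inv, hcinv, mul_assoc, ← mul_assoc c c, hcc, one_mul]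
    refine ⟨⟨hne, _, hne, (conjSubgroup_commutator_eq_bot_iff _ _ _).mpr fun a b => ?_⟩, ?_⟩
    · have key : ∀ a : G, PolyGroup.const G I a * (c * t * c * t⁻¹) *
          (PolyGroup.const G I a)⁻¹ ∈ Subgroup.zpowers (c * t * c * t⁻¹) := by
        intro a
        obtain rfl | rfl := htwo a
        · simp
        · rw [← hc, hconj]
          exact inv_mem (Subgroup.mem_zpowers _)
      obtain ⟨m, hm⟩ := Subgroup.mem_zpowers_iff.mp (key a)
      obtain ⟨n, hn⟩ := Subgroup.mem_zpowers_iff.mp (key b)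
      rw [← hm, ← hn]
      exact Commute.zpow_zpow_self _ m n
    · rintro ⟨a, ha⟩
      -- Killing the indeterminates sends the element to `g * g = 1`.
      have hfst := congrArg (Monoid.Coprod.fst : PolyGroup G I →* G) ha
      have ha1 : a = 1 := by
        simpa [hc, ht, PolyGroup.const, PolyGroup.X, hgg] using hfst
      rw [ha1, map_one] at ha
      exact hne ha.symm
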